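/- Let $\alpha_1,\alpha_2\in\mathbb{C}$ with $|\alpha_1|=|\alpha_2|=1$, neither of which is a non-negative real number, and suppose $\alpha_1\neq\alpha_2$ and $\alpha_2\neq\overline{\alpha_1}$. Let $c_1,c_2$ be nonzero complex numbers and put $$b(n) := c_1\alpha_1^n+\overline{c_1}\,\overline{\alpha_1}^{\,n}+c_2\alpha_2^n+\overline{c_2}\,\overline{\alpha_2}^{\,n},\qquad n\ge 0,$$ which is a sequence of real numbers. Then there is $\delta>0$ such that $b(n)>\delta$ for infinitely many $n$ and $b(n)<-\delta$ for infinitely many $n$. -/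

import Mathlib

open scoped ComplexConjugate

/-- The sequence `b(n) = c₁ α₁ⁿ + c̄₁ ᾱ₁ⁿ + c₂ α₂ⁿ + c̄₂ ᾱ₂ⁿ`, as a sequence of complex numbers. -/
noncomputable def bSeq (α₁ α₂ c₁ c₂ : ℂ) (n : ℕ) : ℂ :=
  c₁ * α₁ ^ n + conj c₁ * conj α₁ ^ n + c₂ * α₂ ^ n + conj c₂ * conj α₂ ^ n

/-! Here `b(n)` is the real part of `2c₁α₁ⁿ + 2c₂α₂ⁿ`. It is recurrent, since both powers return
near `1` together, and its partial sums are bounded, since neither base is `1`. If `b` were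
nonpositive but not identically zero, recurrence would keep infinitely many terms below a fixed
negative number, forcing the sums to `-∞`. The same holds for `-b`, so both signs occur, and
recurrence repeats them infinitely often. That `b` is not identically zero follows by eliminating
one frequency, as the real parts of the bases differ. -/

/-- Two unimodular numbers return simultaneously close to `1` at arbitrarily large exponents. -/
theorem exists_pow_near_one (α β : ℂ) (hα : ‖α‖ = 1) (hβ : ‖β‖ = 1) {ε : ℝ} (hε : 0 < ε) (N : ℕ) :
    ∃ k ≥ N, ‖α ^ k - 1‖ < ε ∧ ‖β ^ k - 1‖ < ε := by
  have hmem : ∀ n : ℕ, ((α ^ n, β ^ n) : ℂ × ℂ) ∈ Metric.closedBall (0 : ℂ × ℂ) 1 := by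
    intro n
    simp [Prod.norm_def, hα, hβ]
  obtain ⟨a, -, φ, hφ, hlim⟩ := (isCompact_closedBall (0 : ℂ × ℂ) 1).tendsto_subseq hmem
  obtain ⟨M, hM⟩ := Metric.cauchySeq_iff.1 hlim.cauchySeq ε hε
  have hd := hM (M + N) (by omega) M le_rfl
  have hle : N + φ M ≤ φ (M + N) := by
    have := hφ.add_le_nat N M
    rwa [add_comm N M] at this
  obtain ⟨j, hj⟩ := Nat.exists_eq_add_of_le hle
  -- Factoring out the unimodular `γ ^ φ M` turns closeness of two powers into closeness of their
  -- quotient to `1`.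
  have key : ∀ γ : ℂ, ‖γ‖ = 1 → ‖γ ^ (N + j) - 1‖ = dist (γ ^ φ (M + N)) (γ ^ φ M) := by
    intro γ hγ
    have : γ ^ φ (M + N) - γ ^ φ M = γ ^ φ M * (γ ^ (N + j) - 1) := by
      rw [hj]; ring
    rw [dist_eq_norm, this, norm_mul, norm_pow, hγ, one_pow, one_mul]
  refine ⟨N + j, by omega, ?_⟩
  rw [key α hα, key β hβ]
  simpa [Prod.dist_eq] using hd

/-- Every value of a recurrent sequence is approximately attained infinitely often. -/
theorem infinite_lt_of_recurrent {b : ℕ → ℝ}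
    (hrec : ∀ ε > 0, ∀ N : ℕ, ∃ k ≥ N, ∀ n, |b (n + k) - b n| < ε) {n₀ : ℕ} {δ : ℝ}
    (h : δ < b n₀) : {n | δ < b n}.Infinite := by
  refine Set.infinite_of_not_bddAbove ?_
  rintro ⟨B, hB⟩
  obtain ⟨k, hk, hb⟩ := hrec (b n₀ - δ) (by linarith) (B + 1)
  have h1 := (abs_lt.1 (hb n₀)).1
  have h2 : n₀ + k ≤ B := hB (show δ < b (n₀ + k) by linarith)
  omega

/-- A nonzero recurrent sequence with bounded partial sums takes a positive value. -/
theorem exists_pos_of_recurrent {b : ℕ → ℝ}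
    (hrec : ∀ ε > 0, ∀ N : ℕ, ∃ k ≥ N, ∀ n, |b (n + k) - b n| < ε)
    {C : ℝ} (hsum : ∀ n, |∑ i ∈ Finset.range n, b i| ≤ C) {n₀ : ℕ} (h0 : b n₀ ≠ 0) :
    ∃ n, 0 < b n := by
  by_contra! hneg
  have hlt : b n₀ < 0 := lt_of_le_of_ne (hneg n₀) h0
  have hinf : {n | -b n₀ / 2 < -b n}.Infinite := by
    refine infinite_lt_of_recurrent (b := fun n => -b n) (n₀ := n₀) ?_ (by linarith)
    intro ε hε N
    obtain ⟨k, hk, h⟩ := hrec ε hε N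
    refine ⟨k, hk, fun n => ?_⟩
    rw [neg_sub_neg, abs_sub_comm]
    exact h n
  obtain ⟨K, hK⟩ := exists_nat_gt (C / (-b n₀ / 2))
  rw [div_lt_iff₀ (by linarith)] at hK
  obtain ⟨t, ht, htc⟩ := hinf.exists_subset_card_eq K
  obtain ⟨M, hM⟩ := t.exists_nat_subset_range
  have h1 : ∑ i ∈ t, -b i ≤ ∑ i ∈ Finset.range M, -b i :=
    Finset.sum_le_sum_of_subset_of_nonneg hM fun i _ _ => by linarith [hneg i]
  have h2 : t.card • (-b n₀ / 2) ≤ ∑ i ∈ t, -b i :=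
    Finset.card_nsmul_le_sum _ _ _ fun i hi => le_of_lt (ht hi)
  rw [htc, nsmul_eq_mul] at h2
  rw [Finset.sum_neg_distrib, Finset.sum_neg_distrib] at h1
  rw [Finset.sum_neg_distrib] at h2
  have h3 := (abs_le.1 (hsum M)).1
  linarith

theorem norm_geom_sum_le {α : ℂ} (hα : ‖α‖ = 1) (h1 : α ≠ 1) (n : ℕ) :
    ‖∑ i ∈ Finset.range n, α ^ i‖ ≤ 2 / ‖α - 1‖ := by
  rw [geom_sum_eq h1, norm_div]
  gcongr
  calc ‖α ^ n - 1‖ ≤ ‖α ^ n‖ + ‖(1 : ℂ)‖ := norm_sub_le _ _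
    _ = 2 := by rw [norm_pow, hα]; norm_num

theorem sq_re_add_sq_im_eq_one {z : ℂ} (hz : ‖z‖ = 1) : z.re ^ 2 + z.im ^ 2 = 1 := by
  have := Complex.sq_norm z
  rw [hz, Complex.normSq_apply] at this
  linarith

theorem re_ne_re_of_norm_eq_one {α β : ℂ} (hα : ‖α‖ = 1) (hβ : ‖β‖ = 1) (h₁ : α ≠ β)
    (h₂ : β ≠ conj α) : β.re ≠ α.re := by
  intro h
  have ha := sq_re_add_sq_im_eq_one hα
  have hb := sq_re_add_sq_im_eq_one hβ
  rw [h] at hb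
  rcases sq_eq_sq_iff_eq_or_eq_neg.1 (show β.im ^ 2 = α.im ^ 2 by linarith) with hi | hi
  · exact h₁ (Complex.ext h.symm hi.symm)
  · exact h₂ (Complex.ext (by simpa using h) (by simpa using hi))

/-- As `z * conj z = 1`, `z` is a root of `X² - 2 Re(z) X + 1`. The real coefficients let this
recurrence act on real parts. -/
theorem sq_add_one_of_norm_eq_one {z : ℂ} (hz : ‖z‖ = 1) :
    z ^ 2 + 1 = 2 * (z.re : ℂ) * z := by
  have h := sq_re_add_sq_im_eq_one hz
  apply Complex.ext <;> simp [pow_two] <;> nlinarith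

/-- If one frequency is not real, the real parts do not all vanish. -/
theorem exists_re_ne_zero_of_im_ne_zero {α β c d : ℂ} (hα : ‖α‖ = 1) (hβ : ‖β‖ = 1)
    (hre : β.re ≠ α.re) (him : β.im ≠ 0) (hd : d ≠ 0) :
    ∃ n : ℕ, (c * α ^ n + d * β ^ n).re ≠ 0 := by
  by_contra! h
  have hz : ∀ n : ℕ, (d * β ^ (n + 1)).re = 0 := by
    intro n
    -- The recurrence of `α` annihilates the `α` term and only rescales the `β` term by a nonzero
    -- real.
    have e : (c * α ^ (n + 2) + d * β ^ (n + 2)) + (c * α ^ n + d * β ^ n)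
        - ((2 * α.re : ℝ) : ℂ) * (c * α ^ (n + 1) + d * β ^ (n + 1))
        = ((2 * (β.re - α.re) : ℝ) : ℂ) * (d * β ^ (n + 1)) := by
      push_cast
      linear_combination c * α ^ n * sq_add_one_of_norm_eq_one hα
        + d * β ^ n * sq_add_one_of_norm_eq_one hβ
    have e' := congrArg Complex.re e
    rw [Complex.sub_re, Complex.add_re, Complex.re_ofReal_mul, Complex.re_ofReal_mul,
      h, h, h] at e'
    have hne : 2 * (β.re - α.re) ≠ 0 := mul_ne_zero two_ne_zero (sub_ne_zero.2 hre)
    refine (mul_eq_zero.1 ?_).resolve_left hne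
    linarith
  -- Both `d * β` and its product with the non-real `β` are purely imaginary, which forces `d * β =
  -- 0`.
  have h0 := hz 0
  have h1 := hz 1
  rw [zero_add, pow_one] at h0
  have e2 : d * β ^ (1 + 1) = d * β * β := by ring
  rw [e2, Complex.mul_re (d * β) β, h0, zero_mul, zero_sub, neg_eq_zero] at h1
  have hzero : d * β = 0 := Complex.ext h0 ((mul_eq_zero.1 h1).resolve_right him)
  have hβ0 : β ≠ 0 := by
    rintro rfl
    simp at him
  exact mul_ne_zero hd hβ0 hzero

theorem exists_re_ne_zero {α β c d : ℂ} (hα : ‖α‖ = 1) (hβ : ‖β‖ = 1)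
    (hre : β.re ≠ α.re) (hα0 : ∀ r : ℝ, 0 ≤ r → α ≠ r) (hβ0 : ∀ r : ℝ, 0 ≤ r → β ≠ r)
    (hc : c ≠ 0) (hd : d ≠ 0) : ∃ n : ℕ, (c * α ^ n + d * β ^ n).re ≠ 0 := by
  by_cases hb : β.im = 0
  · by_cases ha : α.im = 0
    -- Two real bases would both be `-1`, contradicting distinct real parts.
    · have neg_one : ∀ z : ℂ, ‖z‖ = 1 → z.im = 0 → (∀ r : ℝ, 0 ≤ r → z ≠ r) → z.re = -1 := by
        intro z hz hi h0
        have h := sq_re_add_sq_im_eq_one hz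
        rw [hi] at h
        have hneg : z.re < 0 := by
          by_contra! hr
          exact h0 z.re hr (Complex.ext (by simp) (by simpa using hi))
        nlinarith
      exact absurd ((neg_one β hβ hb hβ0).trans (neg_one α hα ha hα0).symm) hre
    · obtain ⟨n, hn⟩ := exists_re_ne_zero_of_im_ne_zero (c := d) hβ hα hre.symm ha hc
      exact ⟨n, by rwa [add_comm]⟩
  · exact exists_re_ne_zero_of_im_ne_zero hα hβ hre hb hd

theorem recurrent_re {α β : ℂ} (c d : ℂ) (hα : ‖α‖ = 1) (hβ : ‖β‖ = 1) :
    ∀ ε > 0, ∀ N : ℕ, ∃ k ≥ N, ∀ n,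
      |(c * α ^ (n + k) + d * β ^ (n + k)).re - (c * α ^ n + d * β ^ n).re| < ε := by
  intro ε hε N
  have hpos : 0 < ‖c‖ + ‖d‖ + 1 := by positivity
  obtain ⟨k, hk, h1, h2⟩ := exists_pow_near_one α β hα hβ (div_pos hε hpos) N
  refine ⟨k, hk, fun n => ?_⟩
  rw [← Complex.sub_re]
  refine (Complex.abs_re_le_norm _).trans_lt ?_
  have e : c * α ^ (n + k) + d * β ^ (n + k) - (c * α ^ n + d * β ^ n)
      = c * α ^ n * (α ^ k - 1) + d * β ^ n * (β ^ k - 1) := by ring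
  rw [e]
  calc _ ≤ ‖c‖ * ‖α ^ k - 1‖ + ‖d‖ * ‖β ^ k - 1‖ := by
        refine (norm_add_le _ _).trans_eq ?_
        simp [hα, hβ]
    _ ≤ ‖c‖ * (ε / (‖c‖ + ‖d‖ + 1)) + ‖d‖ * (ε / (‖c‖ + ‖d‖ + 1)) := by gcongr
    _ = (‖c‖ + ‖d‖) * (ε / (‖c‖ + ‖d‖ + 1)) := by ring
    _ < (‖c‖ + ‖d‖ + 1) * (ε / (‖c‖ + ‖d‖ + 1)) :=
        mul_lt_mul_of_pos_right (lt_add_one _) (div_pos hε hpos)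
    _ = ε := by field_simp

theorem abs_sum_re_le {α β : ℂ} (c d : ℂ) (hα : ‖α‖ = 1) (hβ : ‖β‖ = 1) (hα1 : α ≠ 1)
    (hβ1 : β ≠ 1) (n : ℕ) :
    |∑ i ∈ Finset.range n, (c * α ^ i + d * β ^ i).re|
      ≤ ‖c‖ * (2 / ‖α - 1‖) + ‖d‖ * (2 / ‖β - 1‖) := by
  rw [← Complex.re_sum, Finset.sum_add_distrib, ← Finset.mul_sum, ← Finset.mul_sum]
  refine (Complex.abs_re_le_norm _).trans ((norm_add_le _ _).trans ?_)
  rw [norm_mul, norm_mul]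
  gcongr
  · exact norm_geom_sum_le hα hα1 n
  · exact norm_geom_sum_le hβ hβ1 n

theorem bSeq_eq (α₁ α₂ c₁ c₂ : ℂ) (n : ℕ) :
    bSeq α₁ α₂ c₁ c₂ n = (((2 * c₁) * α₁ ^ n + (2 * c₂) * α₂ ^ n).re : ℝ) := by
  have h := Complex.add_conj (c₁ * α₁ ^ n + c₂ * α₂ ^ n)
  simp only [map_add, map_mul, map_pow] at h
  have e : (2 * c₁) * α₁ ^ n + (2 * c₂) * α₂ ^ n
      = ((2 : ℝ) : ℂ) * (c₁ * α₁ ^ n + c₂ * α₂ ^ n) := by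
    push_cast
    ring
  rw [e, Complex.re_ofReal_mul, ← h, bSeq]
  ring

/-- The first conjunct says that `b(n)` is real, so that its real part is `b(n)` itself. -/
theorem mainTheorem2 (α₁ α₂ c₁ c₂ : ℂ)
    (hα₁ : ∀ r : ℝ, 0 ≤ r → α₁ ≠ (r : ℂ)) (hα₂ : ∀ r : ℝ, 0 ≤ r → α₂ ≠ (r : ℂ))
    (hn₁ : ‖α₁‖ = 1) (hn₂ : ‖α₂‖ = 1)
    (h₁₂ : α₁ ≠ α₂) (h₂₁ : α₂ ≠ conj α₁)
    (hc₁ : c₁ ≠ 0) (hc₂ : c₂ ≠ 0) :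
    (∀ n : ℕ, (bSeq α₁ α₂ c₁ c₂ n).im = 0) ∧
      ∃ δ : ℝ, 0 < δ ∧
        {n : ℕ | δ < (bSeq α₁ α₂ c₁ c₂ n).re}.Infinite ∧
        {n : ℕ | (bSeq α₁ α₂ c₁ c₂ n).re < -δ}.Infinite := by
  refine ⟨fun n => by rw [bSeq_eq, Complex.ofReal_im], ?_⟩
  simp only [bSeq_eq, Complex.ofReal_re]
  have hd₁ : 2 * c₁ ≠ 0 := mul_ne_zero two_ne_zero hc₁
  have hd₂ : 2 * c₂ ≠ 0 := mul_ne_zero two_ne_zero hc₂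
  have h1₁ : α₁ ≠ 1 := by simpa using hα₁ 1 zero_le_one
  have h1₂ : α₂ ≠ 1 := by simpa using hα₂ 1 zero_le_one
  obtain ⟨n₀, h0⟩ := exists_re_ne_zero hn₁ hn₂ (re_ne_re_of_norm_eq_one hn₁ hn₂ h₁₂ h₂₁)
    hα₁ hα₂ hd₁ hd₂
  have hrec := recurrent_re (2 * c₁) (2 * c₂) hn₁ hn₂
  have hsum := abs_sum_re_le (2 * c₁) (2 * c₂) hn₁ hn₂ h1₁ h1₂
  generalize ‖2 * c₁‖ * (2 / ‖α₁ - 1‖) + ‖2 * c₂‖ * (2 / ‖α₂ - 1‖) = C at hsum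
  generalize hb : (fun n : ℕ => (2 * c₁ * α₁ ^ n + 2 * c₂ * α₂ ^ n).re) = b
  have hbn : ∀ n : ℕ, (2 * c₁ * α₁ ^ n + 2 * c₂ * α₂ ^ n).re = b n := fun n => congrFun hb n
  simp only [hbn] at h0 hrec hsum ⊢
  have hrec' : ∀ ε > 0, ∀ N : ℕ, ∃ k ≥ N, ∀ n, |-b (n + k) - -b n| < ε := by
    intro ε hε N
    obtain ⟨k, hk, h⟩ := hrec ε hε N
    refine ⟨k, hk, fun n => ?_⟩
    rw [neg_sub_neg, abs_sub_comm]
    exact h n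
  obtain ⟨p, hp⟩ := exists_pos_of_recurrent hrec hsum h0
  obtain ⟨q, hq⟩ := exists_pos_of_recurrent (b := fun n => -b n) hrec' (C := C) (n₀ := n₀)
    (fun n => by rw [Finset.sum_neg_distrib, abs_neg]; exact hsum n) (neg_ne_zero.2 h0)
  have hm : 0 < min (b p) (-b q) := lt_min hp hq
  refine ⟨min (b p) (-b q) / 2, half_pos hm, ?_, ?_⟩
  · exact infinite_lt_of_recurrent hrec (n₀ := p) (by linarith [min_le_left (b p) (-b q)])
  · have h := infinite_lt_of_recurrent (b := fun n => -b n) hrec' (n₀ := q)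
      (δ := min (b p) (-b q) / 2) (by linarith [min_le_right (b p) (-b q)])
    simpa only [lt_neg] using h
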